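/- Let $\mathrm{Pol}=\mathbb Z[x_1,x_2,\dots]$ and let $\mathrm{Pol}^+\subset\mathrm{Pol}$ be the ideal of polynomials with no constant term. For $i\ge 1$ and $f\in\mathrm{Pol}$ put $$\partial_i f=\frac{f-f(x_1,\dots,x_{i-1},x_{i+1},x_i,x_{i+2},\dots)}{x_i-x_{i+1}},\qquad \mathsf R_i f=f(x_1,\dots,x_{i-1},0,x_i,x_{i+1},\dots),$$ and let $\mathsf Z=\mathrm{id}+\mathsf R_1+\mathsf R_1^2+\cdots:\mathrm{Pol}^+\to\mathrm{Pol}^+$ (for each $f\in \mathrm{Pol}^+$ only finitely many $\mathsf R_1^n f$ are non-zero). Let $S_\infty$ be the group of permutations of $\{1,2,\dots\}$ moving only finitely many points, $s_i=(i,i+1)$, and let $\ell(w)$ be the smallest length of a word in the $s_i$ that equals $w$. Let $\mathrm{Des}(w)=\{i : w(i)>w(i+1)\}$, and let $\mathrm{Red}(w)$ be the set of reduced words of $w$, that is, of sequences $(i_1,\dots,i_k)$ with $k=\ell(w)$ and $w=s_{i_1}\cdots s_{i_k}$. A family of Schubert polynomials is a family $(\mathfrak S_w)_{w\in S_\infty}$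 of homogeneous polynomials in $\mathrm{Pol}$ such that $\mathfrak S_{\mathrm{id}}=1$ and, for all $w\in S_\infty$ and $i\ge 1$, $\partial_i\mathfrak S_w=\mathfrak S_{ws_i}$ if $i\in\mathrm{Des}(w)$ and $\partial_i\mathfrak S_w=0$ otherwise. Then: 1. The operators $f\mapsto \mathsf Z x_i\mathsf R_i f=\mathsf Z\bigl(x_i\cdot(\mathsf R_i f)\bigr)$ ($i\ge 1$) are creation operators for the divided differences $\partial_i$. That is, they are $\mathbb Z$-linear endomorphisms of $\mathrm{Pol}$ of degree $1$ (they map homogeneous polynomials of degree $d$ to homogeneous polynomials of degree $d+1$), and for every $f\in\mathrm{Pol}^+$ only finitely many $\partial_i f$ are non-zero and $$\sum_{i\ge 1}\mathsf Z x_i\mathsf R_i\,\partial_i f=f .$$ 2. Schubert polynomials exist: there is exactly one family of Schubert polynomials $(\mathfrak S_w)_{w\in S_\infty}$. 3. For every $w\in S_\infty$ the set $\mathrm{Red}(w)$ is finite, and $$\mathfrak S_w=\sum_{(i_1,\dots,i_k)\in\mathrm{Red}(w)}\mathsf Z x_{i_k}\mathsf R_{i_k}\cdots\mathsf Z x_{i_1}\mathsf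 R_{i_1}(1).$$ This expansion is monomial positive: every summand is a polynomial with non-negative coefficients. -/

import Mathlib

/- Conventions. All indices start at `0`: the index `i : ℕ` stands for the mathematical index `i + 1`.
So the variable `X i` is `x_{i+1}`, permutations act on `{0, 1, 2, …}` in place of `{1, 2, 3, …}`,
and `s i`, `divDiff i`, `bs i`, `zxr i` are `s_{i+1}`, `∂_{i+1}`, `R_{i+1}`, `Z x_{i+1} R_{i+1}`. -/

namespace SchubertCreation

open MvPolynomial

/-! ### Polynomials in infinitely many variables -/

/-- The ring `Pol = ℤ[x₁, x₂, …]`. -/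
abbrev Pol : Type := MvPolynomial ℕ ℤ

/-- `Pol⁺`, the polynomials with no constant term. -/
noncomputable def PolPlus : Submodule ℤ Pol := LinearMap.ker (lcoeff ℤ (0 : ℕ →₀ ℕ))

theorem mem_polPlus {f : Pol} : f ∈ PolPlus ↔ constantCoeff f = 0 := Iff.rfl

/-! ### Divided differences -/

/-- The exchange of the variables `X i` and `X (i + 1)`. -/
noncomputable def swapVars (i : ℕ) : Pol →ₐ[ℤ] Pol := rename (Equiv.swap i (i + 1))

theorem exists_divDiff (i : ℕ) (f : Pol) :
    ∃ g : Pol, f - swapVars i f = (X i - X (i + 1)) * g := by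
  change (X i - X (i + 1) : Pol) ∣ f - swapVars i f
  induction f using MvPolynomial.induction_on with
  | C a => simp [swapVars]
  | add p q hp hq =>
    have : p + q - swapVars i (p + q) = (p - swapVars i p) + (q - swapVars i q) := by
      rw [map_add]; ring
    rw [this]
    exact dvd_add hp hq
  | mul_X p j hp =>
    have h : (X i - X (i + 1) : Pol) ∣ X j - swapVars i (X j) := by
      simp only [swapVars, rename_X]
      by_cases h1 : j = i
      · subst h1; simp
      · by_cases h2 : j = i + 1
        · subst h2; rw [Equiv.swap_apply_right]; exact ⟨-1, by ring⟩
        · rw [Equiv.swap_apply_of_ne_of_ne h1 h2]; simp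
    have : p * X j - swapVars i (p * X j) =
        (p - swapVars i p) * X j + swapVars i p * (X j - swapVars i (X j)) := by
      rw [map_mul]; ring
    rw [this]
    exact dvd_add (hp.mul_right _) (h.mul_left _)

theorem X_sub_X_ne_zero (i : ℕ) : (X i - X (i + 1) : Pol) ≠ 0 := by
  intro h
  have := X_injective (R := ℤ) (sub_eq_zero.1 h)
  omega

/-- The divided difference `∂`: `divDiff i f = (f - f(…, x_{i+1}, x_i, …)) / (x_i - x_{i+1})`, that is,
the unique polynomial `g` with `f - swapVars i f = (X i - X (i + 1)) * g`. -/
noncomputable def divDiff (i : ℕ) : Module.End ℤ Pol where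
  toFun f := (exists_divDiff i f).choose
  map_add' f g := by
    apply mul_left_cancel₀ (X_sub_X_ne_zero i)
    rw [← (exists_divDiff i (f + g)).choose_spec, mul_add, ← (exists_divDiff i f).choose_spec,
      ← (exists_divDiff i g).choose_spec, map_add]
    ring
  map_smul' c f := by
    apply mul_left_cancel₀ (X_sub_X_ne_zero i)
    rw [← (exists_divDiff i (c • f)).choose_spec, RingHom.id_apply, mul_smul_comm,
      ← (exists_divDiff i f).choose_spec, map_smul, smul_sub]

theorem divDiff_spec (i : ℕ) (f : Pol) :
    (X i - X (i + 1)) * divDiff i f = f - swapVars i f :=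
  (exists_divDiff i f).choose_spec.symm

/-! ### The operators `R`, `Z` and `Z x R` -/

/-- The Bergeron–Sottile map `R`: `f(x₁, x₂, …) ↦ f(x₁, …, x_{i-1}, 0, x_i, x_{i+1}, …)`. -/
noncomputable def bs (i : ℕ) : Pol →ₐ[ℤ] Pol :=
  aeval fun j => if j < i then X j else if j = i then 0 else X (j - 1)

theorem constantCoeff_bs (i : ℕ) (f : Pol) : constantCoeff (bs i f) = constantCoeff f := by
  induction f using MvPolynomial.induction_on with
  | C a => simp [bs]
  | add p q hp hq => simp only [map_add, hp, hq]
  | mul_X p j hp =>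
    simp only [map_mul, bs, aeval_X, constantCoeff_X, mul_zero]
    split_ifs <;> simp

/-- The first Bergeron–Sottile map `R₁`, `f ↦ f(0, x₁, x₂, …)`, as a linear operator. -/
noncomputable def bsFirst : Module.End ℤ Pol := (bs 0).toLinearMap

theorem constantCoeff_bsFirst_pow (n : ℕ) (f : Pol) :
    constantCoeff ((bsFirst ^ n) f) = constantCoeff f := by
  induction n with
  | zero => simp
  | succ n ih =>
    rw [pow_succ', Module.End.mul_apply, ← ih]
    exact constantCoeff_bs 0 _

theorem bsFirst_pow_eventually (f : Pol) :
    ∃ N, ∀ n, N ≤ n → (bsFirst ^ n) f = C (constantCoeff f) := by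
  have hmul : ∀ n (p q : Pol), (bsFirst ^ n) (p * q) = (bsFirst ^ n) p * (bsFirst ^ n) q := by
    intro n
    induction n with
    | zero => simp
    | succ n ih =>
      intro p q
      simp only [pow_succ', Module.End.mul_apply, ih]
      exact map_mul (bs 0) _ _
  induction f using MvPolynomial.induction_on with
  | C a =>
    refine ⟨0, fun n _ => ?_⟩
    induction n with
    | zero => simp
    | succ n ih =>
      rw [pow_succ', Module.End.mul_apply, ih (Nat.zero_le _)]
      simp [bsFirst, bs]
  | add p q hp hq =>
    obtain ⟨N, hN⟩ := hp
    obtain ⟨M, hM⟩ := hq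
    refine ⟨max N M, fun n hn => ?_⟩
    rw [map_add, hN n (le_trans (le_max_left _ _) hn), hM n (le_trans (le_max_right _ _) hn),
      map_add, map_add]
  | mul_X p j _ =>
    refine ⟨j + 1, fun n hn => ?_⟩
    have hX : ∀ m k, k < m → (bsFirst ^ m) (X k : Pol) = 0 := by
      intro m
      induction m with
      | zero => intro k hk; omega
      | succ m ih =>
        intro k hk
        rw [pow_succ, Module.End.mul_apply]
        cases k with
        | zero => simp [bsFirst, bs]
        | succ k =>
          have : bsFirst (X (k + 1) : Pol) = X k := by simp [bsFirst, bs]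
          rw [this]
          exact ih k (by omega)
    rw [hmul, hX n j (by omega)]
    simp

/-- On `Pol⁺` the series `id + R₁ + R₁² + ⋯` is locally finite. -/
theorem finite_support_bsFirst_pow {f : Pol} (hf : f ∈ PolPlus) :
    (Function.support fun n : ℕ => (bsFirst ^ n) f).Finite := by
  obtain ⟨N, hN⟩ := bsFirst_pow_eventually f
  refine (Set.finite_lt_nat N).subset fun n hn => ?_
  by_contra h
  apply hn
  change (bsFirst ^ n) f = 0
  rw [hN n (not_lt.1 h), mem_polPlus.1 hf, map_zero]

/-- `Z = id + R₁ + R₁² + ⋯ : Pol⁺ → Pol⁺`. -/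
noncomputable def Z : PolPlus →ₗ[ℤ] PolPlus where
  toFun f := ⟨∑ᶠ n : ℕ, (bsFirst ^ n) (f : Pol), by
    rw [finsum_eq_sum _ (finite_support_bsFirst_pow f.2)]
    refine Submodule.sum_mem _ fun n _ => ?_
    rw [mem_polPlus, constantCoeff_bsFirst_pow]
    exact mem_polPlus.1 f.2⟩
  map_add' f g := by
    apply Subtype.ext
    simp only [Submodule.coe_add, map_add]
    exact finsum_add_distrib (finite_support_bsFirst_pow f.2) (finite_support_bsFirst_pow g.2)
  map_smul' c f := by
    apply Subtype.ext
    simp only [Submodule.coe_smul, map_smul, RingHom.id_apply]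
    exact (smul_finsum' c (finite_support_bsFirst_pow f.2)).symm

/-- `x R : Pol → Pol⁺`, the map `R` followed by multiplication by the variable of the same index. -/
noncomputable def xr (i : ℕ) : Pol →ₗ[ℤ] PolPlus :=
  LinearMap.codRestrict PolPlus (LinearMap.mulLeft ℤ (X i) ∘ₗ (bs i).toLinearMap) fun f => by
    rw [mem_polPlus]
    simp

/-- The operator `Z x R`, as an endomorphism of `Pol`. -/
noncomputable def zxr (i : ℕ) : Module.End ℤ Pol := PolPlus.subtype ∘ₗ Z ∘ₗ xr i

/-! ### Creation operators -/

/-- The family `Y` consists of creation operators for the operators `D 0, D 1, …`: each `Y i` has degree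
`1`, and `∑ i, Y i ∘ D i = id` on `Pol⁺` (the sum being finite on each polynomial). -/
structure IsCreationOperators (D Y : ℕ → Module.End ℤ Pol) : Prop where
  degree_one : ∀ (i d : ℕ) (f : Pol), f.IsHomogeneous d → (Y i f).IsHomogeneous (d + 1)
  finite_support : ∀ f ∈ PolPlus, {i : ℕ | D i f ≠ 0}.Finite
  sum_eq : ∀ f ∈ PolPlus, ∑ᶠ i : ℕ, Y i (D i f) = f

/-! ### Permutations of finite support and Schubert polynomials -/

/-- The group `S_∞` of permutations moving only finitely many points. -/
def SInf : Subgroup (Equiv.Perm ℕ) where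
  carrier := {w | {j | w j ≠ j}.Finite}
  one_mem' := by simp
  mul_mem' {u v} hu hv := by
    refine (Set.Finite.union hu hv).subset fun j hj => ?_
    by_contra h
    simp only [Set.mem_union, Set.mem_ofPred_eq, not_or, not_not] at h
    exact hj (by rw [Equiv.Perm.mul_apply, h.2, h.1])
  inv_mem' {u} hu := by
    refine Set.Finite.subset hu fun j hj h => hj ?_
    rw [Equiv.Perm.inv_eq_iff_eq]
    exact h.symm

/-- The simple transposition exchanging `i` and `i + 1`. -/
def s (i : ℕ) : SInf :=
  ⟨Equiv.swap i (i + 1), by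
    refine Set.Finite.subset (Set.toFinite {i, i + 1}) fun j hj => ?_
    by_contra h
    simp only [Set.mem_insert_iff, Set.mem_singleton_iff, not_or] at h
    exact hj (Equiv.swap_apply_of_ne_of_ne h.1 h.2)⟩

/-- The length of `w`: the smallest length of a word in the simple transpositions which equals `w`. -/
noncomputable def length (w : SInf) : ℕ :=
  sInf {k | ∃ l : List ℕ, l.length = k ∧ (l.map s).prod = w}

/-- The reduced words of `w`: the `(i_1, …, i_k)` with `k = length w` and `w = s_{i_1} ⋯ s_{i_k}`. -/
def Red (w : SInf) : Set (List ℕ) := {l | l.length = length w ∧ (l.map s).prod = w}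

/-- The descent set of `w`. -/
def Des (w : SInf) : Set ℕ := {i | (w : Equiv.Perm ℕ) i > (w : Equiv.Perm ℕ) (i + 1)}

/-- `S` is a family of Schubert polynomials: homogeneous polynomials indexed by `S_∞` with `S_id = 1`,
`∂_i S_w = S_{w s_i}` if `i` is a descent of `w`, and `∂_i S_w = 0` otherwise. -/
structure IsSchubertFamily (S : SInf → Pol) : Prop where
  homogeneous : ∀ w, ∃ d, (S w).IsHomogeneous d
  one : S 1 = 1
  divDiff_of_mem : ∀ w, ∀ i ∈ Des w, divDiff i (S w) = S (w * s i)
  divDiff_of_notMem : ∀ w, ∀ i ∉ Des w, divDiff i (S w) = 0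

/-- For the word `l = (i_1, …, i_k)`, the polynomial `Z x_{i_k} R_{i_k} ⋯ Z x_{i_1} R_{i_1} (1)`. -/
noncomputable def zxrWord (l : List ℕ) : Pol := l.foldl (fun f i => zxr i f) 1

end SchubertCreation

open SchubertCreation

open SchubertCreation

namespace SchubertCreation

open MvPolynomial

/-! ### Identities between the operators -/

/-! Indices start at 0: write `x_i`, `∂_i`, `R_i` for `X i`, `divDiff i`, `bs i`, so that `Z = ∑
R_0^n`.

Creation: `x_i R_i ∂_i = R_{i+1} - R_i`, and `R_i f = f` for large `i`, so `∑ x_i R_i ∂_i f`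
telescopes to `f - R_0 f`. On `Pol⁺` the geometric series `Z` inverts `id - R_0`, which gives `∑ Z
x_i R_i ∂_i f = f`.

Uniqueness: for `w ≠ 1` a Schubert polynomial has positive degree, hence lies in `Pol⁺`. The
creation identity then expresses it through the `S (w * s i)` with `i` a descent of `w`, and
induction on length applies. Unrolling this recursion gives the sum over reduced words.

Existence: the sum over reduced words must have the right divided differences. This is an
integration problem: the prescribed values `g i` of `∂_i` satisfy the relations in `IsCompatible`,
and these suffice for `∂_j (∑ Z x_i R_i g_i) = g_j` (`IsCompatible.divDiff_finsum_zxr`). The key is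
`∂_j (∑ x_i R_i g_i) = g_j - R_0 g_{j+1}`; applying `Z` makes the right side telescope, because `∂_j
R_0^n = R_0^n ∂_{j+n}`.

Positivity is immediate, since `Z`, `x_i` and `R_i` preserve non-negative coefficients. -/

theorem bs_X (i j : ℕ) : bs i (X j) = if j < i then X j else if j = i then 0 else X (j - 1) := by
  simp [bs]

theorem bs_X_of_lt {i j : ℕ} (h : j < i) : bs i (X j) = X j := by
  rw [bs_X, if_pos h]

theorem bs_X_self (i : ℕ) : bs i (X i) = 0 := by
  simp [bs_X]

theorem bs_X_succ {i j : ℕ} (h : i ≤ j) : bs i (X (j + 1)) = X j := by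
  rw [bs_X, if_neg (by omega), if_neg (by omega), Nat.add_sub_cancel]

theorem swapVars_X (i j : ℕ) :
    swapVars i (X j) = X (if j = i then i + 1 else if j = i + 1 then i else j) := by
  simp [swapVars, Equiv.swap_apply_def]

theorem swapVars_X_left (i : ℕ) : swapVars i (X i) = X (i + 1) := by
  rw [swapVars_X, if_pos rfl]

theorem swapVars_X_right (i : ℕ) : swapVars i (X (i + 1)) = X i := by
  rw [swapVars_X, if_neg (Nat.succ_ne_self i), if_pos rfl]

theorem swapVars_X_of_ne {i j : ℕ} (h : j ≠ i) (h' : j ≠ i + 1) : swapVars i (X j) = X j := by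
  rw [swapVars_X, if_neg h, if_neg h']

theorem divDiff_eq_of_mul_eq {i : ℕ} {f g : Pol}
    (h : (X i - X (i + 1)) * g = f - swapVars i f) : divDiff i f = g :=
  mul_left_cancel₀ (X_sub_X_ne_zero i) ((divDiff_spec i f).trans h.symm)

theorem swapVars_swapVars (i : ℕ) (f : Pol) : swapVars i (swapVars i f) = f := by
  rw [swapVars, rename_rename, ← Equiv.coe_trans, Equiv.swap_swap, Equiv.coe_refl, rename_id_apply]

theorem swapVars_divDiff (i : ℕ) (f : Pol) : swapVars i (divDiff i f) = divDiff i f := by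
  symm
  apply divDiff_eq_of_mul_eq
  have h := congrArg (swapVars i) (divDiff_spec i f)
  rw [map_mul, map_sub, map_sub, swapVars_swapVars, swapVars_X, swapVars_X] at h
  simp only [if_true, Nat.succ_ne_self, if_false] at h
  linear_combination -h

theorem divDiff_divDiff (i : ℕ) (f : Pol) : divDiff i (divDiff i f) = 0 := by
  apply divDiff_eq_of_mul_eq
  rw [swapVars_divDiff, sub_self, mul_zero]

theorem divDiff_C (i : ℕ) (a : ℤ) : divDiff i (C a) = 0 := by
  apply divDiff_eq_of_mul_eq
  simp [swapVars]

theorem divDiff_X_mul (i : ℕ) (f : Pol) :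
    divDiff i (X i * f) = f + X (i + 1) * divDiff i f := by
  apply divDiff_eq_of_mul_eq
  rw [map_mul, swapVars_X, if_pos rfl]
  linear_combination X (i + 1) * divDiff_spec i f

theorem divDiff_X_succ_mul (i : ℕ) (f : Pol) :
    divDiff i (X (i + 1) * f) = -f + X i * divDiff i f := by
  apply divDiff_eq_of_mul_eq
  rw [map_mul, swapVars_X, if_neg (by omega), if_pos rfl]
  linear_combination X i * divDiff_spec i f

theorem divDiff_X_mul_of_ne {i j : ℕ} (h : j ≠ i) (h' : j ≠ i + 1) (f : Pol) :
    divDiff i (X j * f) = X j * divDiff i f := by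
  apply divDiff_eq_of_mul_eq
  rw [map_mul, swapVars_X, if_neg h, if_neg h']
  linear_combination X j * divDiff_spec i f

theorem bs_swapVars (i : ℕ) (f : Pol) : bs i (swapVars i f) = bs (i + 1) f := by
  rw [← AlgHom.comp_apply]
  refine DFunLike.congr_fun ?_ f
  ext1 j
  rw [AlgHom.comp_apply]
  rcases lt_trichotomy j i with h | rfl | h
  · rw [swapVars_X_of_ne h.ne (by omega), bs_X_of_lt h, bs_X_of_lt (by omega)]
  · rw [swapVars_X_left, bs_X_succ le_rfl, bs_X_of_lt (Nat.lt_succ_self j)]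
  · obtain ⟨k, rfl⟩ : ∃ k, j = k + 1 := ⟨j - 1, by omega⟩
    rcases eq_or_ne k i with rfl | h'
    · rw [swapVars_X_right, bs_X_self, bs_X_self]
    · rw [swapVars_X_of_ne (by omega) (by omega), bs_X_succ (by omega), bs_X_succ (by omega)]

/-- The telescoping identity `x_i R_i ∂_i = R_{i+1} - R_i`. -/
theorem X_mul_bs_divDiff (i : ℕ) (f : Pol) :
    X i * bs i (divDiff i f) = bs (i + 1) f - bs i f := by
  -- `R_i` sends `x_i - x_{i+1}` to `-x_i`, and by `bs_swapVars` it turns `f - swapVars i f` into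
  -- `R_i f - R_{i+1} f`.
  have h := congrArg (bs i) (divDiff_spec i f)
  rw [map_mul, map_sub, map_sub, bs_swapVars, bs_X_self, bs_X_succ le_rfl] at h
  linear_combination -h

theorem bs_succ_eq_of_divDiff_eq_zero {i : ℕ} {f : Pol} (h : divDiff i f = 0) :
    bs (i + 1) f = bs i f := by
  have := X_mul_bs_divDiff i f
  rw [h, map_zero, mul_zero] at this
  exact sub_eq_zero.1 this.symm

/-- `R_i` shifts the variables beyond slot `i` down by one, so `x_j, x_{j+1}` come from `x_{j+1},
x_{j+2}`. In `divDiff_bs_of_lt` both variables lie before slot `i` and do not move. The remaining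
case `i = j + 1` has no such rule: there `x_j, x_{j+1}` come from the non-adjacent `x_j, x_{j+2}`.
-/
theorem divDiff_bs_of_le {i j : ℕ} (h : i ≤ j) (f : Pol) :
    divDiff j (bs i f) = bs i (divDiff (j + 1) f) := by
  have hs : swapVars j (bs i f) = bs i (swapVars (j + 1) f) := by
    rw [← AlgHom.comp_apply, ← AlgHom.comp_apply]
    refine DFunLike.congr_fun ?_ f
    ext1 k
    rw [AlgHom.comp_apply, AlgHom.comp_apply]
    rcases lt_trichotomy k i with hk | rfl | hk
    · rw [bs_X_of_lt hk, swapVars_X_of_ne (by omega) (by omega),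
        swapVars_X_of_ne (by omega) (by omega), bs_X_of_lt hk]
    · rw [bs_X_self, swapVars_X_of_ne (by omega) (by omega), bs_X_self, map_zero]
    · obtain ⟨k, rfl⟩ : ∃ m, k = m + 1 := ⟨k - 1, by omega⟩
      rw [bs_X_succ (by omega)]
      rcases eq_or_ne k j with rfl | h1
      · rw [swapVars_X_left, swapVars_X_left, bs_X_succ (by omega)]
      · rcases eq_or_ne k (j + 1) with rfl | h2
        · rw [swapVars_X_right, swapVars_X_right, bs_X_succ (by omega)]
        · rw [swapVars_X_of_ne h1 h2, swapVars_X_of_ne (by omega) (by omega),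
            bs_X_succ (by omega)]
  apply divDiff_eq_of_mul_eq
  have h2 := congrArg (bs i) (divDiff_spec (j + 1) f)
  rwa [map_mul, map_sub, map_sub, bs_X_succ h, bs_X_succ (h.trans (Nat.le_succ j)), ← hs] at h2

theorem divDiff_bs_of_lt {i j : ℕ} (h : j + 1 < i) (f : Pol) :
    divDiff j (bs i f) = bs i (divDiff j f) := by
  have hs : swapVars j (bs i f) = bs i (swapVars j f) := by
    rw [← AlgHom.comp_apply, ← AlgHom.comp_apply]
    refine DFunLike.congr_fun ?_ f
    ext1 k
    rw [AlgHom.comp_apply, AlgHom.comp_apply]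
    rcases lt_trichotomy k i with hk | rfl | hk
    · rw [bs_X_of_lt hk]
      rcases eq_or_ne k j with rfl | h1
      · rw [swapVars_X_left, bs_X_of_lt (by omega)]
      · rcases eq_or_ne k (j + 1) with rfl | h2
        · rw [swapVars_X_right, bs_X_of_lt (by omega)]
        · rw [swapVars_X_of_ne h1 h2, bs_X_of_lt hk]
    · rw [bs_X_self, swapVars_X_of_ne (by omega) (by omega), bs_X_self, map_zero]
    · obtain ⟨k, rfl⟩ : ∃ m, k = m + 1 := ⟨k - 1, by omega⟩
      rw [bs_X_succ (by omega), swapVars_X_of_ne (by omega) (by omega),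
        swapVars_X_of_ne (by omega) (by omega), bs_X_succ (by omega)]
  apply divDiff_eq_of_mul_eq
  have h2 := congrArg (bs i) (divDiff_spec j f)
  rwa [map_mul, map_sub, map_sub, bs_X_of_lt h, bs_X_of_lt (by omega), ← hs] at h2

theorem divDiff_bsFirst_pow (n j : ℕ) (f : Pol) :
    divDiff j ((bsFirst ^ n) f) = (bsFirst ^ n) (divDiff (j + n) f) := by
  induction n generalizing j with
  | zero => simp
  | succ n ih =>
    rw [pow_succ', Module.End.mul_apply, Module.End.mul_apply, Nat.add_left_comm j n 1,
      Nat.add_comm n, ← ih]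
    exact divDiff_bs_of_le (Nat.zero_le j) _

theorem bs_eventually_eq (f : Pol) : ∃ N, ∀ i, N ≤ i → bs i f = f := by
  induction f using MvPolynomial.induction_on with
  | C a => exact ⟨0, fun i _ => by simp [bs]⟩
  | add p q hp hq =>
    obtain ⟨N, hN⟩ := hp
    obtain ⟨M, hM⟩ := hq
    exact ⟨max N M, fun i hi => by rw [map_add, hN i (by omega), hM i (by omega)]⟩
  | mul_X p j hp =>
    obtain ⟨N, hN⟩ := hp
    exact ⟨max N (j + 1), fun i hi => by
      rw [map_mul, hN i (by omega), bs_X_of_lt (by omega)]⟩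

theorem divDiff_eventually_eq_zero (f : Pol) : ∃ N, ∀ i, N ≤ i → divDiff i f = 0 := by
  suffices h : ∃ N, ∀ i, N ≤ i → swapVars i f = f by
    obtain ⟨N, hN⟩ := h
    refine ⟨N, fun i hi => divDiff_eq_of_mul_eq ?_⟩
    rw [hN i hi, sub_self, mul_zero]
  induction f using MvPolynomial.induction_on with
  | C a => exact ⟨0, fun i _ => by simp [swapVars]⟩
  | add p q hp hq =>
    obtain ⟨N, hN⟩ := hp
    obtain ⟨M, hM⟩ := hq
    exact ⟨max N M, fun i hi => by rw [map_add, hN i (by omega), hM i (by omega)]⟩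
  | mul_X p j hp =>
    obtain ⟨N, hN⟩ := hp
    exact ⟨max N (j + 1), fun i hi => by
      rw [map_mul, hN i (by omega), swapVars_X, if_neg (by omega), if_neg (by omega)]⟩

/-! ### The operator `Z` -/

theorem bsFirst_pow_eventually_eq_zero {f : Pol} (hf : f ∈ PolPlus) :
    ∃ N, ∀ n, N ≤ n → (bsFirst ^ n) f = 0 := by
  obtain ⟨N, hN⟩ := bsFirst_pow_eventually f
  exact ⟨N, fun n hn => by rw [hN n hn, mem_polPlus.1 hf, map_zero]⟩

theorem coe_Z_eq_sum (f : PolPlus) {N : ℕ} (hN : ∀ n, N ≤ n → (bsFirst ^ n) (f : Pol) = 0) :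
    (Z f : Pol) = ∑ n ∈ Finset.range N, (bsFirst ^ n) (f : Pol) := by
  refine finsum_eq_finsetSum_of_support_subset _ fun n hn => ?_
  by_contra h
  exact hn (hN n (by simpa using h))

theorem coe_Z_mem_of_forall {P : AddSubmonoid Pol} (f : PolPlus)
    (h : ∀ n, (bsFirst ^ n) (f : Pol) ∈ P) : (Z f : Pol) ∈ P := by
  obtain ⟨N, hN⟩ := bsFirst_pow_eventually_eq_zero f.2
  rw [coe_Z_eq_sum f hN]
  exact P.sum_mem fun n _ => h n

/-- `Z` is a left inverse of `id - R_0` on `Pol⁺`: the partial sums telescope and the last term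
`R_0^n g` vanishes for large `n`. -/
theorem coe_Z_eq_of_eq_sub {f : PolPlus} {g : Pol} (hg : g ∈ PolPlus)
    (h : (f : Pol) = g - bsFirst g) : (Z f : Pol) = g := by
  obtain ⟨N, hN⟩ := bsFirst_pow_eventually_eq_zero f.2
  obtain ⟨M, hM⟩ := bsFirst_pow_eventually_eq_zero hg
  rw [coe_Z_eq_sum f (N := max N M) fun n hn => hN n (le_trans (le_max_left _ _) hn)]
  have : ∀ n, (bsFirst ^ n) (f : Pol) = (bsFirst ^ n) g - (bsFirst ^ (n + 1)) g := fun n => by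
    rw [h, map_sub, pow_succ, Module.End.mul_apply]
  simp only [this, Finset.sum_range_sub', hM _ (le_max_right N M), pow_zero, sub_zero,
    Module.End.one_apply]

theorem coe_xr (i : ℕ) (f : Pol) : (xr i f : Pol) = X i * bs i f := rfl

theorem sum_zxr_eq (g : ℕ → Pol) (N : ℕ) :
    ∑ i ∈ Finset.range N, zxr i (g i) = (Z (∑ i ∈ Finset.range N, xr i (g i)) : Pol) := by
  rw [map_sum, AddSubmonoidClass.coe_finsetSum]
  rfl

theorem isHomogeneous_bs (i : ℕ) {d : ℕ} {f : Pol} (hf : f.IsHomogeneous d) :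
    (bs i f).IsHomogeneous d := by
  have := hf.aeval (S := ℤ) (τ := ℕ) (n := 1)
    (fun j => if j < i then X j else if j = i then 0 else X (j - 1)) (fun j => by
      split_ifs
      · exact isHomogeneous_X _ _
      · exact isHomogeneous_zero _ _ _
      · exact isHomogeneous_X _ _)
  rwa [one_mul] at this

theorem isHomogeneous_zxr (i d : ℕ) (f : Pol) (hf : f.IsHomogeneous d) :
    (zxr i f).IsHomogeneous (d + 1) := by
  have h0 : (xr i f : Pol).IsHomogeneous (d + 1) := by
    rw [coe_xr, add_comm]
    exact (isHomogeneous_X _ _).mul (isHomogeneous_bs i hf)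
  refine coe_Z_mem_of_forall (P := (homogeneousSubmodule ℕ ℤ (d + 1)).toAddSubmonoid) _ fun n => ?_
  change MvPolynomial.IsHomogeneous _ _
  induction n with
  | zero => simpa using h0
  | succ n ih =>
    rw [pow_succ', Module.End.mul_apply]
    exact isHomogeneous_bs 0 ih

theorem isCreationOperators_zxr : IsCreationOperators divDiff zxr where
  degree_one := isHomogeneous_zxr
  finite_support f _ := by
    obtain ⟨N, hN⟩ := divDiff_eventually_eq_zero f
    refine (Set.finite_lt_nat N).subset fun i hi => ?_
    by_contra h
    exact hi (hN i (not_lt.1 h))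
  sum_eq f hf := by
    obtain ⟨N, hN⟩ := divDiff_eventually_eq_zero f
    obtain ⟨M, hM⟩ := bs_eventually_eq f
    rw [finsum_eq_finsetSum_of_support_subset (s := Finset.range (max N M)), sum_zxr_eq]
    · apply coe_Z_eq_of_eq_sub hf
      simp only [AddSubmonoidClass.coe_finsetSum, coe_xr, X_mul_bs_divDiff]
      rw [Finset.sum_range_sub (fun i => bs i f), hM _ (le_max_right _ _)]
      rfl
    · intro i hi
      by_contra h
      refine hi ?_
      simp only [Finset.coe_range, Set.mem_Iio, not_lt] at h
      simp [hN i (le_trans (le_max_left _ _) h)]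

/-! ### Positivity -/

/-- The polynomials with non-negative coefficients. -/
noncomputable def nonnegPol : Subsemiring Pol := (map (Nat.castRingHom ℤ)).rangeS

theorem coeff_nonneg_of_mem_nonnegPol {f : Pol} (hf : f ∈ nonnegPol) (m : ℕ →₀ ℕ) :
    0 ≤ f.coeff m := by
  obtain ⟨g, rfl⟩ := hf
  rw [coeff_map]
  exact Int.natCast_nonneg _

theorem X_mem_nonnegPol (i : ℕ) : X i ∈ nonnegPol := ⟨X i, map_X _ _⟩

theorem bs_mem_nonnegPol (i : ℕ) {f : Pol} (hf : f ∈ nonnegPol) : bs i f ∈ nonnegPol := by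
  obtain ⟨g, rfl⟩ := hf
  induction g using MvPolynomial.induction_on with
  | C a => exact ⟨C a, by simp [bs]⟩
  | add p q hp hq => rw [map_add, map_add]; exact add_mem hp hq
  | mul_X p j hp =>
    rw [map_mul, map_mul, map_X, bs_X]
    refine mul_mem hp ?_
    split_ifs
    exacts [X_mem_nonnegPol _, zero_mem _, X_mem_nonnegPol _]

theorem zxr_mem_nonnegPol (i : ℕ) {f : Pol} (hf : f ∈ nonnegPol) : zxr i f ∈ nonnegPol := by
  refine coe_Z_mem_of_forall (P := nonnegPol.toAddSubmonoid) _ fun n => ?_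
  induction n with
  | zero => exact nonnegPol.mul_mem (X_mem_nonnegPol i) (bs_mem_nonnegPol i hf)
  | succ n ih =>
    rw [pow_succ', Module.End.mul_apply]
    exact bs_mem_nonnegPol 0 ih

theorem zxrWord_append_singleton (l : List ℕ) (i : ℕ) :
    zxrWord (l ++ [i]) = zxr i (zxrWord l) := by
  simp [zxrWord]

theorem zxrWord_mem_nonnegPol (l : List ℕ) : zxrWord l ∈ nonnegPol := by
  induction l using List.reverseRecOn with
  | nil => exact one_mem _
  | append_singleton l i ih =>
    rw [zxrWord_append_singleton]
    exact zxr_mem_nonnegPol i ih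

theorem isHomogeneous_zxrWord (l : List ℕ) : (zxrWord l).IsHomogeneous l.length := by
  induction l using List.reverseRecOn with
  | nil => exact isHomogeneous_one _ _
  | append_singleton l i ih =>
    rw [zxrWord_append_singleton, List.length_append]
    exact isHomogeneous_zxr i _ _ ih

/-! ### Integration of compatible families -/

/-- The conditions on `g` which are necessary for a polynomial `f` with `∂_i f = g i` to exist. -/
structure IsCompatible (g : ℕ → Pol) : Prop where
  divDiff_self : ∀ i, divDiff i (g i) = 0
  comm : ∀ i j, i + 1 < j → divDiff j (g i) = divDiff i (g j)
  braid : ∀ i, divDiff i (divDiff (i + 1) (g i)) = divDiff (i + 1) (divDiff i (g (i + 1)))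

/-- The two terms for which `∂_j` does not commute with `x_i` are treated together; only here is the
braid condition used. -/
theorem IsCompatible.divDiff_adjacent {g : ℕ → Pol} (hg : IsCompatible g) (j : ℕ) :
    divDiff j (X j * bs j (g j) + X (j + 1) * bs (j + 1) (g (j + 1))) =
      bs (j + 2) (g j) - bs j (g (j + 1)) := by
  have e1 := bs_succ_eq_of_divDiff_eq_zero (hg.divDiff_self j)
  have e2 := bs_succ_eq_of_divDiff_eq_zero (hg.divDiff_self (j + 1))
  rw [map_add, divDiff_X_mul, divDiff_X_succ_mul, divDiff_bs_of_le le_rfl]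
  -- `∂_j` cannot be moved past `R_{j+1}`, but `∂_{j+1} g_{j+1} = 0` allows `R_{j+1}` to be replaced
  -- by `R_{j+2}`.
  rw [← e2, divDiff_bs_of_lt (by omega), e2]
  have h1 := X_mul_bs_divDiff (j + 1) (g j)
  have h2 := X_mul_bs_divDiff j (g (j + 1))
  have h3 := X_mul_bs_divDiff j (divDiff (j + 1) (g j))
  have h4 := X_mul_bs_divDiff (j + 1) (divDiff j (g (j + 1)))
  have h5 := bs_succ_eq_of_divDiff_eq_zero (divDiff_divDiff j (g (j + 1)))
  have h6 := bs_succ_eq_of_divDiff_eq_zero (divDiff_divDiff j (divDiff (j + 1) (g j)))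
  -- With `B` the common value of the two sides of the braid condition, `∂_j B = 0` gives `R_{j+1} B
  -- = R_j B`. Hence `x_{j+1}` times `h3` and `x_j` times `h4` have the same left side and can be
  -- cancelled.
  rw [← hg.braid, h6] at h4
  rw [h5] at h4
  linear_combination (-1 : Pol) * e1 + h1 + h2 - X j * h4 + X (j + 1) * h3

/-- The terms `i < j` telescope to `R_j g_{j+1} - R_0 g_{j+1}`, the pair `j, j+1` gives `R_{j+2} g_j
- R_j g_{j+1}`, and the terms from `j+2` on telescope to `g_j - R_{j+2} g_j`. -/
theorem IsCompatible.divDiff_sum {g : ℕ → Pol} (hg : IsCompatible g) (j : ℕ) {N : ℕ}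
    (hN : ∀ i, N ≤ i → bs i (g j) = g j) :
    divDiff j (∑ i ∈ Finset.range (j + 2 + N), X i * bs i (g i)) = g j - bs 0 (g (j + 1)) := by
  rw [Finset.sum_range_add, Finset.sum_range_succ, Finset.sum_range_succ, add_assoc (Finset.sum _ _),
    map_add, map_add, hg.divDiff_adjacent, map_sum, map_sum]
  have h1 : ∀ i ∈ Finset.range j, divDiff j (X i * bs i (g i)) =
      bs (i + 1) (g (j + 1)) - bs i (g (j + 1)) := fun i hi => by
    have hi := Finset.mem_range.1 hi
    rw [divDiff_X_mul_of_ne (by omega) (by omega), divDiff_bs_of_le hi.le,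
      hg.comm i (j + 1) (by omega), X_mul_bs_divDiff]
  have h2 : ∀ i ∈ Finset.range N, divDiff j (X (j + 2 + i) * bs (j + 2 + i) (g (j + 2 + i))) =
      bs (j + 2 + (i + 1)) (g j) - bs (j + 2 + i) (g j) := fun i _ => by
    rw [divDiff_X_mul_of_ne (by omega) (by omega), divDiff_bs_of_lt (by omega),
      ← hg.comm j (j + 2 + i) (by omega), X_mul_bs_divDiff, add_assoc (j + 2)]
  rw [Finset.sum_congr rfl h1, Finset.sum_congr rfl h2,
    Finset.sum_range_sub (fun i => bs i (g (j + 1))),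
    Finset.sum_range_sub (fun i => bs (j + 2 + i) (g j)), hN (j + 2 + N) (by omega)]
  rw [add_zero]
  ring

/-- A compatible family `g` with finitely many non-zero members is integrated by `∑ i, Z x_i R_i (g i)`. -/
theorem IsCompatible.divDiff_finsum_zxr {g : ℕ → Pol} (hg : IsCompatible g) {M : ℕ}
    (hM : ∀ i, M ≤ i → g i = 0) (j : ℕ) : divDiff j (∑ᶠ i, zxr i (g i)) = g j := by
  rw [finsum_eq_finsetSum_of_support_subset (s := Finset.range M), sum_zxr_eq]
  swap
  · intro i hi
    by_contra h
    refine hi ?_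
    simp only [Finset.coe_range, Set.mem_Iio, not_lt] at h
    simp [hM i h]
  set F := ∑ i ∈ Finset.range M, xr i (g i)
  have hF : ∀ k, divDiff k (F : Pol) = g k - bsFirst (g (k + 1)) := fun k => by
    obtain ⟨N, hN⟩ := bs_eventually_eq (g k)
    have h := hg.divDiff_sum k (N := N + M) fun i hi => hN i (by omega)
    -- The range is lengthened to the form required by `divDiff_sum`; the terms from `M` on vanish.
    rw [show k + 2 + (N + M) = M + (k + 2 + N) by omega, Finset.sum_range_add,
      Finset.sum_eq_zero (s := Finset.range (k + 2 + N)), add_zero] at h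
    · rw [AddSubmonoidClass.coe_finsetSum]
      exact h
    · intro i _
      rw [hM _ (Nat.le_add_right M i), map_zero, mul_zero]
  obtain ⟨N, hN⟩ := bsFirst_pow_eventually_eq_zero F.2
  -- `N` terms exhaust the series for `Z F`; the extra `M` make the boundary term contain `g (j + (N
  -- + M)) = 0`.
  rw [coe_Z_eq_sum F (N := N + M) fun n hn => hN n (by omega), map_sum]
  have : ∀ n, divDiff j ((bsFirst ^ n) (F : Pol)) =
      (bsFirst ^ n) (g (j + n)) - (bsFirst ^ (n + 1)) (g (j + (n + 1))) := fun n => by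
    rw [divDiff_bsFirst_pow, hF, map_sub, pow_succ, Module.End.mul_apply, add_assoc]
  simp only [this]
  rw [Finset.sum_range_sub' (fun n => (bsFirst ^ n) (g (j + n))), hM (j + (N + M)) (by omega)]
  simp

/-! ### Words and descents -/

theorem coe_s_apply (i j : ℕ) :
    (s i : Equiv.Perm ℕ) j = if j = i then i + 1 else if j = i + 1 then i else j :=
  Equiv.swap_apply_def _ _ _

theorem coe_mul_s_apply (w : SInf) (i j : ℕ) : ((w * s i : SInf) : Equiv.Perm ℕ) j =
    (w : Equiv.Perm ℕ) (if j = i then i + 1 else if j = i + 1 then i else j) := by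
  rw [← coe_s_apply]; rfl

theorem coe_s_mul_apply (w : SInf) (i j : ℕ) : ((s i * w : SInf) : Equiv.Perm ℕ) j =
    (s i : Equiv.Perm ℕ) ((w : Equiv.Perm ℕ) j) := rfl

theorem s_mul_s (i : ℕ) : s i * s i = 1 := Subtype.ext (Equiv.swap_mul_self _ _)

theorem mul_s_mul_s (w : SInf) (i : ℕ) : w * s i * s i = w := by
  rw [mul_assoc, s_mul_s, mul_one]

theorem s_mul_s_mul (w : SInf) (i : ℕ) : s i * (s i * w) = w := by
  rw [← mul_assoc, s_mul_s, one_mul]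

theorem mem_Des {w : SInf} {i : ℕ} :
    i ∈ Des w ↔ (w : Equiv.Perm ℕ) (i + 1) < (w : Equiv.Perm ℕ) i := Iff.rfl

theorem apply_ne_apply_succ (w : SInf) (i : ℕ) :
    (w : Equiv.Perm ℕ) i ≠ (w : Equiv.Perm ℕ) (i + 1) := fun h => by
  have := (w : Equiv.Perm ℕ).injective h
  omega

theorem mem_Des_mul_s_self {w : SInf} {i : ℕ} : i ∈ Des (w * s i) ↔ i ∉ Des w := by
  have := apply_ne_apply_succ w i
  simp only [mem_Des, coe_mul_s_apply, if_true, Nat.succ_ne_self, if_false]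
  omega

theorem mem_Des_mul_s_of_far {w : SInf} {i j : ℕ} (h : i + 1 < j ∨ j + 1 < i) :
    j ∈ Des (w * s i) ↔ j ∈ Des w := by
  rw [mem_Des, mem_Des, coe_mul_s_apply, coe_mul_s_apply, if_neg (by omega), if_neg (by omega),
    if_neg (by omega), if_neg (by omega)]

theorem notMem_Des_one (i : ℕ) : i ∉ Des 1 := by
  simp [mem_Des]

theorem s_comm {i j : ℕ} (h : i + 1 < j) : s i * s j = s j * s i := by
  apply Subtype.ext
  ext k
  change (s i : Equiv.Perm ℕ) ((s j : Equiv.Perm ℕ) k) = (s j : Equiv.Perm ℕ) ((s i : Equiv.Perm ℕ) k)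
  simp only [coe_s_apply]
  split_ifs <;> omega

theorem s_braid (i : ℕ) : s i * s (i + 1) * s i = s (i + 1) * s i * s (i + 1) := by
  apply Subtype.ext
  ext k
  change (s i : Equiv.Perm ℕ) ((s (i + 1) : Equiv.Perm ℕ) ((s i : Equiv.Perm ℕ) k)) =
    (s (i + 1) : Equiv.Perm ℕ) ((s i : Equiv.Perm ℕ) ((s (i + 1) : Equiv.Perm ℕ) k))
  simp only [coe_s_apply]
  split_ifs <;> omega

theorem exists_forall_le_apply_eq (w : SInf) : ∃ N, ∀ j, N ≤ j → (w : Equiv.Perm ℕ) j = j := by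
  obtain ⟨N, hN⟩ := Set.Finite.bddAbove w.2
  refine ⟨N + 1, fun j hj => ?_⟩
  by_contra h
  have := hN h
  omega

theorem Des_finite (w : SInf) : (Des w).Finite := by
  obtain ⟨N, hN⟩ := exists_forall_le_apply_eq w
  refine (Set.finite_lt_nat N).subset fun i hi => ?_
  by_contra h
  have h : N ≤ i := not_lt.1 h
  rw [mem_Des, hN i h, hN (i + 1) (by omega)] at hi
  omega

theorem exists_word (w : SInf) : ∃ l : List ℕ, (l.map s).prod = w := by
  suffices h : ∀ N (w : SInf), (∀ j, N ≤ j → (w : Equiv.Perm ℕ) j = j) →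
      ∃ l : List ℕ, (l.map s).prod = w by
    obtain ⟨N, hN⟩ := exists_forall_le_apply_eq w
    exact h N w hN
  intro N
  induction N with
  | zero => exact fun w hw => ⟨[], Subtype.ext (Equiv.ext fun j => (hw j (Nat.zero_le j)).symm)⟩
  | succ N ih =>
    -- Here `k = N - w N`. Left multiplication by `s (w N)` raises the value at `N` by one, until
    -- `N` is fixed and the outer induction applies.
    have main : ∀ k (w : SInf), (∀ j, N + 1 ≤ j → (w : Equiv.Perm ℕ) j = j) →
        (w : Equiv.Perm ℕ) N + k = N → ∃ l : List ℕ, (l.map s).prod = w := by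
      intro k
      induction k with
      | zero =>
        refine fun w hw hk => ih w fun j hj => ?_
        rcases hj.eq_or_lt with rfl | hj
        · exact hk
        · exact hw j hj
      | succ k ihk =>
        intro w hw hk
        obtain ⟨l, hl⟩ := ihk (s ((w : Equiv.Perm ℕ) N) * w) (fun j hj => by
            rw [coe_s_mul_apply, hw j hj, coe_s_apply, if_neg (by omega), if_neg (by omega)])
          (by rw [coe_s_mul_apply, coe_s_apply, if_pos rfl]; omega)
        exact ⟨(w : Equiv.Perm ℕ) N :: l, by
          rw [List.map_cons, List.prod_cons, hl, s_mul_s_mul]⟩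
    intro w hw
    have hle : (w : Equiv.Perm ℕ) N ≤ N := by
      by_contra h
      have := (w : Equiv.Perm ℕ).injective (hw _ (not_le.1 h))
      omega
    exact main (N - (w : Equiv.Perm ℕ) N) w hw (by omega)

theorem Red_nonempty (w : SInf) : (Red w).Nonempty := by
  obtain ⟨l, hl⟩ := exists_word w
  exact Nat.sInf_mem (s := {k | ∃ l : List ℕ, l.length = k ∧ (l.map s).prod = w})
    ⟨l.length, l, rfl, hl⟩

theorem length_le {w : SInf} {l : List ℕ} (h : (l.map s).prod = w) : length w ≤ l.length :=
  Nat.sInf_le ⟨l, rfl, h⟩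

theorem length_one : length 1 = 0 := Nat.le_zero.1 (length_le (l := []) rfl)

theorem length_mul_s_le (w : SInf) (i : ℕ) : length (w * s i) ≤ length w + 1 := by
  obtain ⟨l, hl, rfl⟩ := Red_nonempty w
  rw [← hl]
  refine (length_le (l := l ++ [i]) ?_).trans (by simp)
  simp

/-- The exchange property. -/
theorem exists_word_mul_s {i : ℕ} (l : List ℕ) (hi : i ∈ Des (l.map s).prod) :
    ∃ l' : List ℕ, l'.length + 1 = l.length ∧ (l'.map s).prod = (l.map s).prod * s i := by
  induction l with
  | nil => exact absurd hi (notMem_Des_one i)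
  | cons a t ih =>
    rw [List.map_cons, List.prod_cons] at hi ⊢
    by_cases h : i ∈ Des (t.map s).prod
    · obtain ⟨l', h1, h2⟩ := ih h
      exact ⟨a :: l', by simp [h1], by rw [List.map_cons, List.prod_cons, h2, mul_assoc]⟩
    -- The first letter `a` is the one to delete. Since `s a` only exchanges the values `a` and `a +
    -- 1`, it can create a descent at `i` only if `u i = a` and `u (i + 1) = a + 1`, and then `s a *
    -- u = u * s i`.
    · refine ⟨t, rfl, ?_⟩
      generalize (t.map s).prod = u at hi h ⊢
      have hne := apply_ne_apply_succ u i
      rw [mem_Des] at h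
      rw [mem_Des, coe_s_mul_apply, coe_s_mul_apply, coe_s_apply, coe_s_apply] at hi
      have h1 : (u : Equiv.Perm ℕ) i = a := by split_ifs at hi <;> omega
      have h2 : (u : Equiv.Perm ℕ) (i + 1) = a + 1 := by split_ifs at hi <;> omega
      have : s a * u = u * s i := by
        apply Subtype.ext
        change Equiv.swap a (a + 1) * (u : Equiv.Perm ℕ) = (u : Equiv.Perm ℕ) * Equiv.swap i (i + 1)
        rw [Equiv.mul_swap_eq_swap_mul, h1, h2]
      rw [this, mul_s_mul_s]

theorem length_mul_s_of_mem {w : SInf} {i : ℕ} (hi : i ∈ Des w) :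
    length (w * s i) + 1 = length w := by
  obtain ⟨l, hl, rfl⟩ := Red_nonempty w
  obtain ⟨l', h1, h2⟩ := exists_word_mul_s l hi
  have := length_le h2
  have h3 := length_mul_s_le ((l.map s).prod * s i) i
  rw [mul_s_mul_s] at h3
  omega

theorem length_mul_s_of_notMem {w : SInf} {i : ℕ} (hi : i ∉ Des w) :
    length (w * s i) = length w + 1 := by
  have := length_mul_s_of_mem (mem_Des_mul_s_self.2 hi)
  rw [mul_s_mul_s] at this
  exact this.symm

theorem Red_one : Red 1 = {[]} := by
  ext l
  rw [Set.mem_singleton_iff, ← List.length_eq_zero_iff, ← length_one]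
  refine ⟨fun h => h.1, fun h => ⟨h, ?_⟩⟩
  rw [length_one, List.length_eq_zero_iff] at h
  rw [h]
  rfl

/-- The last letter of a reduced word is a descent, since removing it shortens the permutation;
conversely, a descent can be appended to any reduced word of `w * s i`. -/
theorem Red_eq_biUnion {w : SInf} (hw : w ≠ 1) :
    Red w = ⋃ i ∈ Des w, (fun l => l ++ [i]) '' Red (w * s i) := by
  ext l
  simp only [Set.mem_iUnion, Set.mem_image, exists_prop]
  constructor
  · rintro ⟨hl, rfl⟩
    rcases List.eq_nil_or_concat' l with rfl | ⟨t, i, rfl⟩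
    · exact absurd rfl hw
    have hp : ((t ++ [i]).map s).prod = (t.map s).prod * s i := by simp
    rw [hp] at hl ⊢
    rw [List.length_append, List.length_singleton] at hl
    have ht := length_le (w := (t.map s).prod) rfl
    have hi : i ∈ Des ((t.map s).prod * s i) := by
      by_contra hi
      have := length_mul_s_of_notMem hi
      rw [mul_s_mul_s] at this
      omega
    refine ⟨i, hi, t, ⟨?_, (mul_s_mul_s _ _).symm⟩, rfl⟩
    have := length_mul_s_of_mem hi
    omega
  · rintro ⟨i, hi, t, ⟨ht, hp⟩, rfl⟩
    refine ⟨?_, by simp [hp, mul_s_mul_s]⟩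
    rw [List.length_append, List.length_singleton, ht, length_mul_s_of_mem hi]

theorem Red_finite (w : SInf) : (Red w).Finite := by
  induction h : length w using Nat.strong_induction_on generalizing w with
  | _ n ih =>
    by_cases hw : w = 1
    · rw [hw, Red_one]
      exact Set.finite_singleton _
    · rw [Red_eq_biUnion hw]
      refine (Des_finite w).biUnion fun i hi => Set.Finite.image _ (ih _ ?_ _ rfl)
      have := length_mul_s_of_mem hi
      omega

theorem Des_nonempty {w : SInf} (hw : w ≠ 1) : (Des w).Nonempty := by
  obtain ⟨l, hl⟩ := Red_nonempty w
  rw [Red_eq_biUnion hw, Set.mem_iUnion₂] at hl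
  obtain ⟨i, hi, _⟩ := hl
  exact ⟨i, hi⟩

theorem descent_induction {P : SInf → Prop} (one : P 1)
    (step : ∀ w, w ≠ 1 → (∀ v, length v < length w → P v) → P w) (w : SInf) : P w := by
  induction h : length w using Nat.strong_induction_on generalizing w with
  | _ n ih =>
    by_cases hw : w = 1
    · rwa [hw]
    · exact step w hw fun v hv => ih _ (h ▸ hv) v rfl

/-! ### Schubert polynomials -/

/-- The Schubert polynomial of `w`, as the sum of `Z x_{i_k} R_{i_k} ⋯ Z x_{i_1} R_{i_1} (1)` over the reduced
words of `w`. -/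
noncomputable def schubert (w : SInf) : Pol := ∑ᶠ l ∈ Red w, zxrWord l

theorem schubert_one : schubert 1 = 1 := by
  rw [schubert, Red_one, finsum_mem_singleton]
  rfl

theorem schubert_eq_finsum {w : SInf} (hw : w ≠ 1) :
    schubert w = ∑ᶠ i ∈ Des w, zxr i (schubert (w * s i)) := by
  rw [schubert, Red_eq_biUnion hw, finsum_mem_biUnion _ (Des_finite w)
    fun i _ => (Red_finite _).image _]
  · refine finsum_mem_congr rfl fun i _ => ?_
    rw [finsum_mem_image fun a _ b _ h => List.append_cancel_right h, schubert,
      ← LinearMap.toAddMonoidHom_coe, AddMonoidHom.map_finsum_mem _ _ (Red_finite _)]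
    exact finsum_mem_congr rfl fun l _ => zxrWord_append_singleton l i
  · intro i _ j _ hij
    refine Set.disjoint_left.2 ?_
    rintro _ ⟨a, _, rfl⟩ ⟨b, _, h⟩
    have := (List.append_inj' h rfl).2
    exact hij (by simpa using this.symm)

theorem isHomogeneous_schubert (w : SInf) : (schubert w).IsHomogeneous (length w) := by
  rw [schubert, finsum_mem_eq_finite_toFinset_sum _ (Red_finite w)]
  refine IsHomogeneous.sum _ _ _ fun l hl => ?_
  rw [Set.Finite.mem_toFinset] at hl
  exact hl.1 ▸ isHomogeneous_zxrWord l

open Classical in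
/-- The prescribed value of `∂_i` at the member of index `w` of a family. -/
noncomputable def descend (S : SInf → Pol) (w : SInf) (i : ℕ) : Pol :=
  if i ∈ Des w then S (w * s i) else 0

theorem descend_of_mem {S : SInf → Pol} {w : SInf} {i : ℕ} (h : i ∈ Des w) :
    descend S w i = S (w * s i) := by
  rw [descend, if_pos h]

theorem descend_of_notMem {S : SInf → Pol} {w : SInf} {i : ℕ} (h : i ∉ Des w) :
    descend S w i = 0 := by
  rw [descend, if_neg h]

theorem finsum_mem_Des_eq (S : SInf → Pol) (w : SInf) :
    ∑ᶠ i ∈ Des w, zxr i (S (w * s i)) = ∑ᶠ i, zxr i (descend S w i) := by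
  classical
  refine finsum_congr fun i => ?_
  by_cases h : i ∈ Des w
  · rw [finsum_eq_if, if_pos h, descend_of_mem h]
  · rw [finsum_eq_if, if_neg h, descend_of_notMem h, map_zero]

/-- The conditions reflect the Coxeter relations. When every step is a descent, both sides are the
member of `S` indexed by the same permutation; otherwise both vanish. -/
theorem isCompatible_descend {S : SInf → Pol} {w : SInf}
    (hS : ∀ v, length v < length w → ∀ i, divDiff i (S v) = descend S v i) :
    IsCompatible (descend S w) := by
  have lt {v : SInf} {i : ℕ} (h : i ∈ Des v) : length (v * s i) < length v := by
    have := length_mul_s_of_mem h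
    omega
  have key {i j : ℕ} (h : i ∈ Des w) :
      divDiff j (descend S w i) = descend S (w * s i) j := by
    rw [descend_of_mem h, hS _ (lt h)]
  have key' {i j k : ℕ} (h : i ∈ Des w) (h' : j ∈ Des (w * s i)) :
      divDiff k (divDiff j (descend S w i)) = descend S (w * s i * s j) k := by
    rw [key h, descend_of_mem h', hS _ ((lt h').trans (lt h))]
  refine ⟨fun i => ?_, fun i j hij => ?_, fun i => ?_⟩
  · by_cases h : i ∈ Des w
    · rw [key h, descend_of_notMem]
      rw [mem_Des_mul_s_self]
      exact not_not.2 h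
    · rw [descend_of_notMem h, map_zero]
  · by_cases hi : i ∈ Des w <;> by_cases hj : j ∈ Des w
    · rw [key hi, key hj, descend_of_mem ((mem_Des_mul_s_of_far (Or.inl hij)).2 hj),
        descend_of_mem ((mem_Des_mul_s_of_far (Or.inr hij)).2 hi), mul_assoc, mul_assoc,
        s_comm hij]
    · rw [key hi, descend_of_notMem hj, map_zero,
        descend_of_notMem (mt (mem_Des_mul_s_of_far (Or.inl hij)).1 hj)]
    · rw [key hj, descend_of_notMem hi, map_zero,
        descend_of_notMem (mt (mem_Des_mul_s_of_far (Or.inr hij)).1 hi)]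
    · rw [descend_of_notMem hi, descend_of_notMem hj, map_zero, map_zero]
  · -- both sides vanish unless `w i > w (i + 1) > w (i + 2)`
    have n1 : i + 1 + 1 ≠ i := by omega
    have n2 : i ≠ i + 1 + 1 := by omega
    have e1 : i + 1 ∈ Des (w * s i) ↔ (w : Equiv.Perm ℕ) (i + 2) < (w : Equiv.Perm ℕ) i := by
      simp [mem_Des, coe_s_apply, n1]
    have e2 : i ∈ Des (w * s (i + 1)) ↔ (w : Equiv.Perm ℕ) (i + 2) < (w : Equiv.Perm ℕ) i := by
      simp [mem_Des, coe_s_apply, n2]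
    have e3 : i ∈ Des (w * s i * s (i + 1)) ↔ i + 1 ∈ Des w := by
      simp [mem_Des, coe_s_apply, n1, n2]
    have e4 : i + 1 ∈ Des (w * s (i + 1) * s i) ↔ i ∈ Des w := by
      simp [mem_Des, coe_s_apply, n1, n2]
    by_cases h1 : i ∈ Des w <;> by_cases h2 : i + 1 ∈ Des w
    · have h : (w : Equiv.Perm ℕ) (i + 2) < (w : Equiv.Perm ℕ) i :=
        lt_trans (mem_Des.1 h2) (mem_Des.1 h1)
      rw [key' h1 (e1.2 h), key' h2 (e2.2 h), descend_of_mem (e3.2 h2), descend_of_mem (e4.2 h1)]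
      simp only [mul_assoc]
      rw [← mul_assoc (s i), s_braid, mul_assoc]
    · rw [descend_of_notMem h2, map_zero, map_zero]
      by_cases h : i + 1 ∈ Des (w * s i)
      · rw [key' h1 h, descend_of_notMem (mt e3.1 h2)]
      · rw [key h1, descend_of_notMem h, map_zero]
    · rw [descend_of_notMem h1, map_zero, map_zero]
      by_cases h : i ∈ Des (w * s (i + 1))
      · rw [key' h2 h, descend_of_notMem (mt e4.1 h1)]
      · rw [key h2, descend_of_notMem h, map_zero]
    · rw [descend_of_notMem h1, descend_of_notMem h2]
      simp only [map_zero]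

theorem divDiff_schubert (w : SInf) : ∀ i, divDiff i (schubert w) = descend schubert w i := by
  induction w using descent_induction with
  | one =>
    intro i
    rw [descend_of_notMem (notMem_Des_one i), schubert_one, ← C_1, divDiff_C]
  | step w hw ih =>
    obtain ⟨M, hM⟩ := (Des_finite w).bddAbove
    intro i
    rw [schubert_eq_finsum hw, finsum_mem_Des_eq]
    refine (isCompatible_descend ih).divDiff_finsum_zxr (M := M + 1) (fun j hj => ?_) i
    refine descend_of_notMem fun h => ?_
    have := hM h
    omega

theorem isSchubertFamily_schubert : IsSchubertFamily schubert where
  homogeneous w := ⟨_, isHomogeneous_schubert w⟩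
  one := schubert_one
  divDiff_of_mem w i hi := by rw [divDiff_schubert, descend_of_mem hi]
  divDiff_of_notMem w i hi := by rw [divDiff_schubert, descend_of_notMem hi]

theorem IsSchubertFamily.divDiff_eq {S : SInf → Pol} (hS : IsSchubertFamily S) (w : SInf) (i : ℕ) :
    divDiff i (S w) = descend S w i := by
  by_cases h : i ∈ Des w
  · rw [descend_of_mem h, hS.divDiff_of_mem w i h]
  · rw [descend_of_notMem h, hS.divDiff_of_notMem w i h]

/-- Successive descents lead from `S w` down to `S 1 = 1` by divided differences. -/
theorem IsSchubertFamily.ne_zero {S : SInf → Pol} (hS : IsSchubertFamily S) (w : SInf) :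
    S w ≠ 0 := by
  induction w using descent_induction with
  | one => rw [hS.one]; exact one_ne_zero
  | step w hw ih =>
    obtain ⟨i, hi⟩ := Des_nonempty hw
    intro h
    refine ih (w * s i) ?_ ?_
    · have := length_mul_s_of_mem hi
      omega
    · rw [← hS.divDiff_of_mem w i hi, h, map_zero]

theorem IsSchubertFamily.mem_polPlus {S : SInf → Pol} (hS : IsSchubertFamily S) {w : SInf}
    (hw : w ≠ 1) : S w ∈ PolPlus := by
  obtain ⟨d, hd⟩ := hS.homogeneous w
  obtain ⟨i, hi⟩ := Des_nonempty hw
  rcases Nat.eq_zero_or_pos d with rfl | hpos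
  -- In degree 0 the polynomial would be constant, so its divided difference `S (w * s i)` would
  -- vanish.
  · exfalso
    apply hS.ne_zero (w * s i)
    rw [← hS.divDiff_of_mem w i hi,
      totalDegree_eq_zero_iff_eq_C.1 (Nat.le_zero.1 hd.totalDegree_le), divDiff_C]
  · rw [SchubertCreation.mem_polPlus]
    exact hd.coeff_eq_zero (by simpa using hpos.ne)

theorem IsSchubertFamily.eq_schubert {S : SInf → Pol} (hS : IsSchubertFamily S) (w : SInf) :
    S w = schubert w := by
  induction w using descent_induction with
  | one => rw [hS.one, schubert_one]
  | step w hw ih =>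
    rw [schubert_eq_finsum hw, ← isCreationOperators_zxr.sum_eq _ (hS.mem_polPlus hw)]
    simp only [hS.divDiff_eq]
    rw [← finsum_mem_Des_eq]
    refine finsum_mem_congr rfl fun i hi => ?_
    rw [ih]
    have := length_mul_s_of_mem hi
    omega

end SchubertCreation

theorem corollary3p2 :
    IsCreationOperators divDiff zxr ∧
    (∃! S : SInf → Pol, IsSchubertFamily S) ∧
    ∀ S : SInf → Pol, IsSchubertFamily S → ∀ w : SInf,
      (Red w).Finite ∧
      S w = ∑ᶠ l ∈ Red w, zxrWord l ∧
      ∀ l ∈ Red w, ∀ m : ℕ →₀ ℕ, 0 ≤ (zxrWord l).coeff m :=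
  ⟨isCreationOperators_zxr,
    ⟨schubert, isSchubertFamily_schubert, fun _ hS => funext hS.eq_schubert⟩,
    fun _ hS w => ⟨Red_finite w, hS.eq_schubert w,
      fun l _ m => coeff_nonneg_of_mem_nonnegPol (zxrWord_mem_nonnegPol l) m⟩⟩
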